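/- All vector spaces, algebras and tensor products are over $\mathbb C$, and Hermitian forms are linear in the first argument and conjugate-linear in the second. Fix $N\in\mathbb N=\{0,1,2,\dots\}$. Let $P=\mathbb C[x,y,z,w]$, and let $P_N$ be the subspace of homogeneous polynomials of degree $N$. Endow $P$ with the Hermitian form for which the monomials $x^ry^sz^tw^u$ are mutually orthogonal and $\Vert x^ry^sz^tw^u\Vert^2=r!\,s!\,t!\,u!$. Let $H(N,2)$ be the $N$-cube: its vertex set $X$ consists of the $N$-tuples with entries in $\{1,-1\}$, and two vertices are adjacent whenever they differ in exactly one coordinate. Let $\partial$ be the path-length distance, let $G$ be the automorphism group of $H(N,2)$, and let $V$ be the vector space with basis $X$. The group $G$ acts on $V$ by permuting $X$ and on $V^{\otimes 3}$ by $g(u\otimes v\otimes w)=g(u)\otimes g(v)\otimes g(w)$; let ${\rm Fix}(G)=\{v\in V^{\otimes 3} \mid g(v)=v\ \forall g\in G\}$. The profile of $x\otimes y\otimes z$ $(x,y,z\in X)$ is $(r,s,t,u)$, where $r,s,t,u$ are the numbers of coordinates $i$ with, respectively, $x_i=y_i=z_i$; $x_i\ne y_i=z_i$; $y_i\neq z_i=x_i$;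 $z_i\ne x_i=y_i$. For $r,s,t,u\in\mathbb N$ with $r+s+t+u=N$ let $B(r,s,t,u)\in {\rm Fix}(G)$ be the sum of all $x\otimes y\otimes z$ with profile $(r,s,t,u)$, and let $\tilde B(r,s,t,u)=\frac{r!\,s!\,t!\,u!}{N!\,2^N}B(r,s,t,u)$. Let $\ddag:P_N\to{\rm Fix}(G)$ be the linear map sending $x^ry^sz^tw^u\mapsto (N!\,2^N)^{1/2}\,\tilde B(r,s,t,u)$ for all such $(r,s,t,u)$. Fix a vertex $\varkappa\in X$. Let $\mathsf A,\mathsf A^*\in{\rm End}(V)$ be the maps with $\mathsf A x=\sum_{\xi\text{ adjacent to }x}\xi$ and $\mathsf A^*x=(N-2\partial(x,\varkappa))x$ for $x\in X$, and let $T$ be the (unital) subalgebra of ${\rm End}(V)$ generated by $\mathsf A,\mathsf A^*$. For $x,y\in X$ let $e_{x,y}\in{\rm End}(V)$ send $y\mapsto x$ and all other vertices to $0$; endow ${\rm End}(V)$, and hence $T$, with the Hermitian form for which the basis $\{e_{x,y}\}_{x,y\in X}$ is orthonormal. Let $\varepsilon:V^{\otimes3}\to{\rm End}(V)$ be the linear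 map sending $x\otimes y\otimes z$ $(x,y,z\in X)$ to $2^{N/2}e_{y,z}$ if $x=\varkappa$ and to $0$ if $x\ne\varkappa$. The composition $\varepsilon\circ\ddag$ takes values in $T$; let $\vartheta:P_N\to T$ be the resulting linear map. Theorem. For all $f,g\in P_N$, $$\langle f,g\rangle=\langle\vartheta(f),\vartheta(g)\rangle .$$ -/

import Mathlib

open scoped TensorProduct

namespace HypercubeIso

noncomputable section

/-! ### Hermitian forms attached to orthogonal bases -/

/-- The Hermitian form on `W` (linear in the first argument, conjugate-linear in the second) with
respect to which the vectors of the basis `b` are mutually orthogonal and `‖b i‖² = c i`. -/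
def hermForm {ι W : Type*} [AddCommGroup W] [Module ℂ W] (b : Module.Basis ι ℂ W) (c : ι → ℝ)
    (f g : W) : ℂ :=
  (b.repr f).sum fun i a => (c i : ℂ) * (a * (starRingEnd ℂ) (b.repr g i))

/-! ### The polynomial algebra `P = ℂ[x, y, z, w]` -/

/-- `P = ℂ[x, y, z, w]`; the variables with index `0, 1, 2, 3` are `x, y, z, w`. -/
abbrev Poly : Type := MvPolynomial (Fin 4) ℂ

/-- The homogeneous component `P_N`. -/
abbrev PolyN (N : ℕ) : Submodule ℂ Poly := MvPolynomial.homogeneousSubmodule (Fin 4) ℂ N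

/-- The product `r! s! t! u!` for `d = (r, s, t, u)`. -/
def factProd (d : Fin 4 →₀ ℕ) : ℕ :=
  (d 0).factorial * (d 1).factorial * (d 2).factorial * (d 3).factorial

/-- The Hermitian form on `P`: monomials are mutually orthogonal and
`‖x^r y^s z^t w^u‖² = r! s! t! u!`. -/
def polyForm (f g : Poly) : ℂ :=
  hermForm (MvPolynomial.basisMonomials (Fin 4) ℂ) (fun d => (factProd d : ℝ)) f g

/-! ### The hypercube `H(N, 2)` and its standard module -/

/-- The vertex set: `N`-tuples of elements of `{1, -1}` (the units of `ℤ`). -/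
abbrev Vertex (N : ℕ) : Type := Fin N → ℤˣ

/-- The hypercube: vertices are adjacent when they differ in exactly one coordinate. -/
def hypercube (N : ℕ) : SimpleGraph (Vertex N) where
  Adj x y := ∃! i, x i ≠ y i
  symm := ⟨fun _ _ ⟨i, hi, h⟩ => ⟨i, hi.symm, fun j hj => h j hj.symm⟩⟩
  loopless := ⟨fun _ ⟨_, hi, _⟩ => hi rfl⟩

instance (N : ℕ) : DecidableRel (hypercube N).Adj := fun _ _ => Classical.dec _

variable {N : ℕ}

/-- The path-length distance in the hypercube. -/
abbrev pathDist (x y : Vertex N) : ℕ := (hypercube N).dist x y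

/-- The standard module: the vector space with basis the vertex set. -/
abbrev StdMod (N : ℕ) : Type := Vertex N →₀ ℂ

/-- The basis of the standard module given by the vertices. -/
abbrev vertexBasis (N : ℕ) : Module.Basis (Vertex N) ℂ (StdMod N) := Finsupp.basisSingleOne

/-- `V ⊗ V ⊗ V`. -/
abbrev StdMod3 (N : ℕ) : Type := StdMod N ⊗[ℂ] (StdMod N ⊗[ℂ] StdMod N)

/-- The basis `x ⊗ y ⊗ z` of `V ⊗ V ⊗ V`. -/
def vertexBasis3 (N : ℕ) : Module.Basis (Vertex N × Vertex N × Vertex N) ℂ (StdMod3 N) :=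
  (vertexBasis N).tensorProduct ((vertexBasis N).tensorProduct (vertexBasis N))

/-- The action on `V` of an automorphism of the hypercube. -/
def gAct (g : hypercube N ≃g hypercube N) : StdMod N →ₗ[ℂ] StdMod N := Finsupp.lmapDomain ℂ ℂ g

/-- The action on `V ⊗ V ⊗ V` of an automorphism of the hypercube:
`g (u ⊗ v ⊗ w) = g u ⊗ g v ⊗ g w`. -/
def gAct3 (g : hypercube N ≃g hypercube N) : StdMod3 N →ₗ[ℂ] StdMod3 N :=
  TensorProduct.map (gAct g) (TensorProduct.map (gAct g) (gAct g))

/-- `Fix(G)`: the vectors of `V ⊗ V ⊗ V` fixed by every automorphism of the hypercube. -/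
def fixG (N : ℕ) : Submodule ℂ (StdMod3 N) :=
  ⨅ g : hypercube N ≃g hypercube N, LinearMap.eqLocus (gAct3 g) LinearMap.id

/-- The profile `(r, s, t, u)` of `x ⊗ y ⊗ z`. -/
def profile (x y z : Vertex N) : Fin 4 → ℕ :=
  ![(Finset.univ.filter fun i => x i = y i ∧ y i = z i).card,
    (Finset.univ.filter fun i => x i ≠ y i ∧ y i = z i).card,
    (Finset.univ.filter fun i => y i ≠ z i ∧ z i = x i).card,
    (Finset.univ.filter fun i => z i ≠ x i ∧ x i = y i).card]

/-- `B(r, s, t, u)`: the sum of the `x ⊗ y ⊗ z` with profile `d = (r, s, t, u)`. -/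
def profSum (N : ℕ) (d : Fin 4 →₀ ℕ) : StdMod3 N :=
  ∑ p : Vertex N × Vertex N × Vertex N with profile p.1 p.2.1 p.2.2 = ⇑d, vertexBasis3 N p

/-- `B̃(r, s, t, u) = (r! s! t! u! / (N! 2^N)) B(r, s, t, u)`. -/
def profSumDual (N : ℕ) (d : Fin 4 →₀ ℕ) : StdMod3 N :=
  ((factProd d : ℂ) / ((N.factorial : ℂ) * 2 ^ N)) • profSum N d

/-! ### The subconstituent algebra -/

/-- The adjacency map of the hypercube. -/
def adjMap (N : ℕ) : Module.End ℂ (StdMod N) :=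
  (vertexBasis N).constr ℂ fun x => ∑ ξ with (hypercube N).Adj x ξ, vertexBasis N ξ

/-- The dual adjacency map with respect to the vertex `κ`; here `θ*_i = N - 2 i`. -/
def dualAdjMap (κ : Vertex N) : Module.End ℂ (StdMod N) :=
  (vertexBasis N).constr ℂ fun x => ((N : ℂ) - 2 * (pathDist x κ : ℂ)) • vertexBasis N x

/-- The subconstituent (Terwilliger) algebra `T = T(κ)`. -/
def subconstAlg (κ : Vertex N) : Subalgebra ℂ (Module.End ℂ (StdMod N)) :=
  Algebra.adjoin ℂ {adjMap N, dualAdjMap κ}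

/-- The basis of `End(V)` formed by the maps `e_{x,y}`, indexed by the pairs `(x, y)`: the map
`e_{x,y}` sends `y ↦ x` and all other vertices to `0`. -/
def unitBasis (N : ℕ) : Module.Basis (Vertex N × Vertex N) ℂ (Module.End ℂ (StdMod N)) :=
  (vertexBasis N).linearMap (vertexBasis N)

/-- The Hermitian form on `End(V)` with respect to which the `e_{x,y}` are orthonormal. -/
def endForm (f g : Module.End ℂ (StdMod N)) : ℂ := hermForm (unitBasis N) (fun _ => 1) f g

/-- The linear map `ε : V ⊗ V ⊗ V → End(V)` sending `x ⊗ y ⊗ z` to `2^{N/2} e_{y,z}` if `x = κ`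
and to `0` otherwise. -/
def epsMap (κ : Vertex N) : StdMod3 N →ₗ[ℂ] Module.End ℂ (StdMod N) :=
  (vertexBasis3 N).constr ℂ fun p =>
    if p.1 = κ then (((2 : ℝ) ^ ((N : ℝ) / 2) : ℝ) : ℂ) • unitBasis N (p.2.1, p.2.2) else 0

/-! ### Distances and profiles -/

/-- Change the sign of the `i`-th coordinate. -/
def flipAt (i : Fin N) (x : Vertex N) : Vertex N := Function.update x i (-x i)

lemma neg_ne_self' (a : ℤˣ) : -a ≠ a := by
  rcases Int.units_eq_one_or a with rfl | rfl <;> decide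

lemma eq_neg_of_ne' {a b : ℤˣ} (h : a ≠ b) : a = -b := by
  rcases Int.units_eq_one_or a with rfl | rfl <;> rcases Int.units_eq_one_or b with rfl | rfl <;>
    first | exact absurd rfl h | decide

lemma adj_iff_flipAt (x y : Vertex N) : (hypercube N).Adj x y ↔ ∃ i, y = flipAt i x := by
  constructor
  · rintro ⟨i, hi, h⟩
    refine ⟨i, funext fun j => ?_⟩
    by_cases hj : j = i
    · subst hj; simp [flipAt, eq_neg_of_ne' (Ne.symm hi)]
    · have : x j = y j := by by_contra hne; exact hj (h j hne)
      simp [flipAt, hj, this]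
  · rintro ⟨i, rfl⟩
    refine ⟨i, by simp [flipAt], fun j hj => ?_⟩
    by_contra hne; exact hj (by simp [flipAt, hne])

lemma flipAt_same (i : Fin N) (y : Vertex N) : flipAt i y i = -y i := by simp [flipAt]

lemma flipAt_other {i j : Fin N} (y : Vertex N) (h : j ≠ i) : flipAt i y j = y j := by
  simp [flipAt, h]

lemma hamming_flipAt (x y : Vertex N) (i : Fin N) :
    (x i = y i → hammingDist x (flipAt i y) = hammingDist x y + 1) ∧
    (x i ≠ y i → hammingDist x (flipAt i y) + 1 = hammingDist x y) := by
  constructor <;> intro h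
  · have : (Finset.univ.filter fun j => x j ≠ flipAt i y j)
        = insert i (Finset.univ.filter fun j => x j ≠ y j) := by
      ext j
      simp only [Finset.mem_filter, Finset.mem_univ, true_and, Finset.mem_insert]
      by_cases hj : j = i
      · subst hj; simp [flipAt_same, h]
      · simp [flipAt_other y hj, hj]
    rw [hammingDist, this, Finset.card_insert_of_notMem (by simp [h])]; rfl
  · have : (Finset.univ.filter fun j => x j ≠ y j)
        = insert i (Finset.univ.filter fun j => x j ≠ flipAt i y j) := by
      ext j
      simp only [Finset.mem_filter, Finset.mem_univ, true_and, Finset.mem_insert]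
      by_cases hj : j = i
      · subst hj; simp [h]
      · simp [flipAt_other y hj, hj]
    rw [hammingDist, hammingDist, this, Finset.card_insert_of_notMem
      (by simp [flipAt_same, eq_neg_of_ne' h])]

lemma hamming_le_walk {x y : Vertex N} (p : (hypercube N).Walk x y) :
    hammingDist x y ≤ p.length := by
  induction p with
  | nil => simp
  | @cons u v w h p ih =>
    obtain ⟨i, rfl⟩ := (adj_iff_flipAt u v).1 h
    have := hamming_flipAt w u i
    rw [SimpleGraph.Walk.length_cons]
    rw [hammingDist_comm] at ih ⊢
    by_cases hi : w i = u i
    · have := this.1 hi; omega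
    · have := this.2 hi; omega

lemma exists_walk_hamming (n : ℕ) : ∀ x y : Vertex N, hammingDist x y = n →
    ∃ p : (hypercube N).Walk x y, p.length = n := by
  induction n with
  | zero => intro x y h; obtain rfl := hammingDist_eq_zero.1 h; exact ⟨.nil, rfl⟩
  | succ n ih =>
    intro x y h
    have hne : x ≠ y := by rintro rfl; simp at h
    obtain ⟨i, hi⟩ := Function.ne_iff.1 hne
    have h1 := (hamming_flipAt y x i).2 (Ne.symm hi)
    rw [hammingDist_comm] at h
    obtain ⟨p, hp⟩ := ih (flipAt i x) y (by rw [hammingDist_comm]; omega)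
    exact ⟨.cons ((adj_iff_flipAt _ _).2 ⟨i, rfl⟩) p, by simp [hp]⟩

/-- The path-length distance is the number of coordinates at which two vertices differ. -/
lemma pathDist_eq (x y : Vertex N) : pathDist x y = hammingDist x y := by
  obtain ⟨p, hp⟩ := exists_walk_hamming _ x y rfl
  refine le_antisymm (hp ▸ SimpleGraph.dist_le p) ?_
  obtain ⟨q, hq⟩ := p.reachable.exists_walk_length_eq_dist
  exact (hamming_le_walk q).trans_eq hq

lemma pathDist_le (x y : Vertex N) : pathDist x y ≤ N := by
  rw [pathDist_eq]; simpa using hammingDist_le_card_fintype (x := x) (y := y)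

lemma pathDist_iso (g : hypercube N ≃g hypercube N) (x y : Vertex N) :
    pathDist (g x) (g y) = pathDist x y := by
  have key : ∀ (g : hypercube N ≃g hypercube N) (x y : Vertex N),
      pathDist (g x) (g y) ≤ pathDist x y := by
    intro g x y
    obtain ⟨p, -⟩ := exists_walk_hamming _ x y rfl
    obtain ⟨q, hq⟩ := p.reachable.exists_walk_length_eq_dist
    have := SimpleGraph.dist_le (q.map g.toHom)
    rw [SimpleGraph.Walk.length_map, hq] at this
    exact this
  refine le_antisymm (key g x y) ?_
  simpa using key g.symm (g x) (g y)

lemma profile_dist (x y z : Vertex N) :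
    pathDist x y = profile x y z 1 + profile x y z 2 ∧
    pathDist y z = profile x y z 2 + profile x y z 3 ∧
    pathDist z x = profile x y z 3 + profile x y z 1 ∧
    profile x y z 0 + profile x y z 1 + profile x y z 2 + profile x y z 3 = N := by
  have tri : ∀ a b c : ℤˣ, a = b ∨ b = c ∨ c = a := by decide
  simp only [pathDist_eq, hammingDist, profile, Matrix.cons_val]
  have hN : N = (Finset.univ : Finset (Fin N)).card := by simp
  refine ⟨?_, ?_, ?_, ?_⟩
  · rw [← Finset.card_union_of_disjoint]
    · congr 1; ext i; have := tri (x i) (y i) (z i); simp; grind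
    · rw [Finset.disjoint_filter]; grind
  · rw [← Finset.card_union_of_disjoint]
    · congr 1; ext i; have := tri (x i) (y i) (z i); simp; grind
    · rw [Finset.disjoint_filter]; grind
  · rw [← Finset.card_union_of_disjoint]
    · congr 1; ext i; have := tri (x i) (y i) (z i); simp; grind
    · rw [Finset.disjoint_filter]; grind
  · rw [← Finset.card_union_of_disjoint, ← Finset.card_union_of_disjoint,
      ← Finset.card_union_of_disjoint]
    · conv_rhs => rw [hN]
      congr 1; ext i; have := tri (x i) (y i) (z i); simp; grind
    all_goals rw [Finset.disjoint_left]; simp; grind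

/-- The profile is determined by the three distances. -/
lemma profile_eq_iff (x y z : Vertex N) (d : Fin 4 →₀ ℕ) (hd : d 0 + d 1 + d 2 + d 3 = N) :
    profile x y z = ⇑d ↔
      pathDist x y = d 1 + d 2 ∧ pathDist y z = d 2 + d 3 ∧ pathDist z x = d 3 + d 1 := by
  obtain ⟨h1, h2, h3, h4⟩ := profile_dist x y z
  constructor
  · intro h; rw [h] at h1 h2 h3; exact ⟨h1, h2, h3⟩
  · rintro ⟨g1, g2, g3⟩
    funext i
    fin_cases i <;> simp <;> omega

lemma profile_iso (g : hypercube N ≃g hypercube N) (x y z : Vertex N) :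
    profile (g x) (g y) (g z) = profile x y z := by
  obtain ⟨h1, h2, h3, h4⟩ := profile_dist x y z
  obtain ⟨g1, g2, g3, g4⟩ := profile_dist (g x) (g y) (g z)
  rw [pathDist_iso] at g1 g2 g3
  funext i
  fin_cases i <;> simp <;> omega

lemma gAct3_vertexBasis3 (g : hypercube N ≃g hypercube N)
    (p : Vertex N × Vertex N × Vertex N) :
    gAct3 g (vertexBasis3 N p) = vertexBasis3 N (g p.1, g p.2.1, g p.2.2) := by
  obtain ⟨x, y, z⟩ := p
  simp [vertexBasis3, gAct3, gAct, Module.Basis.tensorProduct_apply, Finsupp.mapDomain_single]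

lemma profSum_mem_fixG (d : Fin 4 →₀ ℕ) : profSum N d ∈ fixG N := by
  simp only [fixG, Submodule.mem_iInf, LinearMap.mem_eqLocus, LinearMap.id_apply]
  intro g
  rw [profSum, map_sum]
  simp only [gAct3_vertexBasis3]
  refine Finset.sum_bij' (fun p _ => (g p.1, g p.2.1, g p.2.2))
    (fun p _ => (g.symm p.1, g.symm p.2.1, g.symm p.2.2)) ?_ ?_ ?_ ?_ ?_
  · intro p hp; simpa [profile_iso] using hp
  · intro p hp; simpa [profile_iso] using hp
  · intro p _; simp
  · intro p _; simp
  · intro p _; rfl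

/-! ### Elements of the subconstituent algebra -/

/-- The distance-`h` map `A_h`. -/
def distMap (N h : ℕ) : Module.End ℂ (StdMod N) :=
  (vertexBasis N).constr ℂ fun x => ∑ ξ with pathDist x ξ = h, vertexBasis N ξ

/-- The dual primitive idempotent `E*_i`. -/
def dualIdem (κ : Vertex N) (i : ℕ) : Module.End ℂ (StdMod N) :=
  (vertexBasis N).constr ℂ fun x => if pathDist x κ = i then vertexBasis N x else 0

lemma adjMap_apply (x : Vertex N) :
    adjMap N (vertexBasis N x) = ∑ ξ with (hypercube N).Adj x ξ, vertexBasis N ξ :=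
  Module.Basis.constr_basis _ _ _ _

lemma dualAdjMap_apply (κ x : Vertex N) :
    dualAdjMap κ (vertexBasis N x) = ((N : ℂ) - 2 * (pathDist x κ : ℂ)) • vertexBasis N x :=
  Module.Basis.constr_basis _ _ _ _

lemma distMap_apply (h : ℕ) (x : Vertex N) :
    distMap N h (vertexBasis N x) = ∑ ξ with pathDist x ξ = h, vertexBasis N ξ :=
  Module.Basis.constr_basis _ _ _ _

lemma dualIdem_apply (κ : Vertex N) (i : ℕ) (x : Vertex N) :
    dualIdem κ i (vertexBasis N x) = if pathDist x κ = i then vertexBasis N x else 0 :=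
  Module.Basis.constr_basis _ _ _ _

lemma dualIdem_mem (κ : Vertex N) (i : ℕ) : dualIdem κ i ∈ subconstAlg κ := by
  by_cases hi : i ≤ N
  · let v : ℕ → ℂ := fun k => (N : ℂ) - 2 * (k : ℂ)
    have hv : Function.Injective v := fun a b h => by simpa [v] using h
    have : dualIdem κ i = Polynomial.aeval (dualAdjMap κ)
        (Lagrange.basis (Finset.range (N + 1)) v i) := by
      refine (vertexBasis N).ext fun x => ?_
      have hx : (dualAdjMap κ).HasEigenvector (v (pathDist x κ)) (vertexBasis N x) :=
        ⟨Module.End.mem_eigenspace_iff.2 (dualAdjMap_apply κ x), (vertexBasis N).ne_zero x⟩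
      rw [Module.End.aeval_apply_of_hasEigenvector hx, dualIdem_apply]
      have hx' := pathDist_le x κ
      split_ifs with h
      · rw [h, Lagrange.eval_basis_self hv.injOn (by simp; omega), one_smul]
      · rw [Lagrange.eval_basis_of_ne (Ne.symm h) (by simp; omega), zero_smul]
    rw [this]
    exact Algebra.adjoin_mono (by simp) (Polynomial.aeval_mem_adjoin_singleton ℂ _)
  · have : dualIdem κ i = 0 := by
      refine (vertexBasis N).ext fun x => ?_
      have hx' := pathDist_le x κ
      rw [dualIdem_apply, if_neg (by omega)]; rfl
    rw [this]; exact zero_mem _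

lemma flipAt_injective (y : Vertex N) : Function.Injective fun i => flipAt i y := by
  intro i j h
  by_contra hij
  have := congrFun h i
  simp [flipAt, hij] at this

lemma card_neighbors (x y : Vertex N) (h : ℕ) :
    ((Finset.univ.filter fun ξ => pathDist x ξ = h + 1 ∧ (hypercube N).Adj ξ y).card : ℂ)
      = (if pathDist x y = h then (N : ℂ) - h else 0)
        + (if pathDist x y = h + 2 then (h : ℂ) + 2 else 0) := by
  have e1 : (Finset.univ.filter fun ξ => pathDist x ξ = h + 1 ∧ (hypercube N).Adj ξ y)
      = (Finset.univ.filter fun i => pathDist x (flipAt i y) = h + 1).image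
          fun i => flipAt i y := by
    ext ξ
    simp only [Finset.mem_filter, Finset.mem_univ, true_and, Finset.mem_image,
      (hypercube N).adj_comm _ y, adj_iff_flipAt]
    constructor
    · rintro ⟨a, i, rfl⟩; exact ⟨i, a, rfl⟩
    · rintro ⟨i, a, rfl⟩; exact ⟨a, i, rfl⟩
  rw [e1, Finset.card_image_of_injective _ (flipAt_injective y)]
  simp only [pathDist_eq]
  have hc : (Finset.univ.filter fun i => x i = y i).card + hammingDist x y = N := by
    have := Finset.card_filter_add_card_filter_not (s := (Finset.univ : Finset (Fin N)))
      (fun i => x i = y i)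
    simpa [hammingDist] using this
  by_cases h1 : hammingDist x y = h
  · have : (Finset.univ.filter fun i => hammingDist x (flipAt i y) = h + 1)
        = Finset.univ.filter fun i => x i = y i := by
      ext i; have := hamming_flipAt x y i; simp
      constructor
      · intro h2; by_contra h3; have := this.2 h3; omega
      · intro h2; have := this.1 h2; omega
    rw [this, if_pos h1, if_neg (by omega), add_zero, eq_sub_iff_add_eq]
    rw [h1] at hc
    exact_mod_cast hc
  · by_cases h2 : hammingDist x y = h + 2
    · have : (Finset.univ.filter fun i => hammingDist x (flipAt i y) = h + 1)
          = Finset.univ.filter fun i => x i ≠ y i := by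
        ext i; have := hamming_flipAt x y i; simp
        constructor
        · intro h3 h4; have := this.1 h4; omega
        · intro h3; have := this.2 h3; omega
      rw [this, if_neg h1, if_pos h2, zero_add]
      have : (Finset.univ.filter fun i => x i ≠ y i).card = h + 2 := h2
      rw [this]; push_cast; ring
    · have : (Finset.univ.filter fun i => hammingDist x (flipAt i y) = h + 1) = ∅ := by
        ext i; have := hamming_flipAt x y i; simp
        intro h3
        by_cases h4 : x i = y i
        · have := this.1 h4; omega
        · have := this.2 h4; omega
      rw [this, if_neg h1, if_neg h2]; simp

lemma adjMap_mul_distMap (h : ℕ) :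
    adjMap N * distMap N (h + 1)
      = ((N : ℂ) - h) • distMap N h + ((h : ℂ) + 2) • distMap N (h + 2) := by
  refine (vertexBasis N).ext fun x => ?_
  rw [Module.End.mul_apply, LinearMap.add_apply, LinearMap.smul_apply, LinearMap.smul_apply]
  simp only [distMap_apply, map_sum, adjMap_apply]
  ext y
  simp only [Finsupp.coe_finsetSum, Finset.sum_apply, Finsupp.add_apply, Finsupp.smul_apply,
    Finsupp.coe_basisSingleOne, Finsupp.single_apply, Finset.sum_ite_eq', Finset.mem_filter,
    Finset.mem_univ, true_and, smul_eq_mul, mul_ite, mul_one, mul_zero]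
  rw [← card_neighbors x y h, Finset.sum_boole, Finset.filter_filter]

lemma mem_of_recurrence {R : Type*} [Ring R] [Algebra ℂ R] (S : Subalgebra ℂ R) {a b : ℂ}
    {u v w : R} (hb : b ≠ 0) (h : u = a • v + b • w) (hu : u ∈ S) (hv : v ∈ S) : w ∈ S := by
  have : w = b⁻¹ • (u - a • v) := by
    rw [h, add_sub_cancel_left, smul_smul, inv_mul_cancel₀ hb, one_smul]
  rw [this]
  exact S.smul_mem (S.sub_mem hu (S.smul_mem hv _)) _

lemma distMap_mem (κ : Vertex N) (h : ℕ) : distMap N h ∈ subconstAlg κ := by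
  have hA : adjMap N ∈ subconstAlg κ := Algebra.subset_adjoin (by simp)
  suffices H : distMap N h ∈ subconstAlg κ ∧ distMap N (h + 1) ∈ subconstAlg κ from H.1
  induction h with
  | zero =>
    constructor
    · have : distMap N 0 = 1 := by
        refine (vertexBasis N).ext fun x => ?_
        rw [distMap_apply]
        have : (Finset.univ.filter fun ξ => pathDist x ξ = 0) = {x} := by
          ext ξ; simp only [pathDist_eq, hammingDist_eq_zero]; simp [eq_comm]
        rw [this]; simp
      rw [this]; exact one_mem _
    · have : distMap N (0 + 1) = adjMap N := by
        refine (vertexBasis N).ext fun x => ?_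
        rw [distMap_apply, adjMap_apply]
        congr 1; ext ξ; simp [SimpleGraph.dist_eq_one_iff_adj]
      rw [this]; exact hA
  | succ h ih =>
    refine ⟨ih.2, ?_⟩
    have hne : ((h : ℂ) + 2) ≠ 0 := by exact_mod_cast (by omega : h + 2 ≠ 0)
    have hm : adjMap N * distMap N (h + 1) ∈ subconstAlg κ := (subconstAlg κ).mul_mem hA ih.2
    exact mem_of_recurrence (R := Module.End ℂ (StdMod N)) (subconstAlg κ) hne
      (adjMap_mul_distMap h) hm ih.1

lemma epsMap_profSum_mem (κ : Vertex N) (d : Fin 4 →₀ ℕ) :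
    epsMap κ (profSum N d) ∈ subconstAlg κ := by
  by_cases hd : d 0 + d 1 + d 2 + d 3 = N
  · have key : epsMap κ (profSum N d) = (((2 : ℝ) ^ ((N : ℝ) / 2) : ℝ) : ℂ) •
        (dualIdem κ (d 1 + d 2) * distMap N (d 2 + d 3) * dualIdem κ (d 3 + d 1)) := by
      refine (vertexBasis N).ext fun ψ => ?_
      rw [profSum, map_sum, LinearMap.smul_apply, Module.End.mul_apply, Module.End.mul_apply,
        dualIdem_apply, LinearMap.sum_apply]
      have e : ∀ p : Vertex N × Vertex N × Vertex N, epsMap κ (vertexBasis3 N p) (vertexBasis N ψ)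
          = (((2 : ℝ) ^ ((N : ℝ) / 2) : ℝ) : ℂ) •
            (if p.1 = κ ∧ p.2.2 = ψ then vertexBasis N p.2.1 else 0) := by
        intro p
        rw [epsMap, Module.Basis.constr_basis]
        by_cases h : p.1 = κ
        · rw [if_pos h, LinearMap.smul_apply, unitBasis, Module.Basis.linearMap_apply_apply]
          simp [h]
        · simp [h]
      simp only [e]
      rw [← Finset.smul_sum]
      congr 1
      rw [← Finset.sum_filter, Finset.filter_filter]
      have e2 : ∀ y, pathDist y κ = pathDist κ y := fun y => SimpleGraph.dist_comm
      have e3 : ∀ y, pathDist y ψ = pathDist ψ y := fun y => SimpleGraph.dist_comm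
      have inner : ∑ y with (profile κ y ψ = ⇑d), vertexBasis N y
          = (dualIdem κ (d 1 + d 2)) ((distMap N (d 2 + d 3))
            (if pathDist ψ κ = d 3 + d 1 then vertexBasis N ψ else 0)) := by
        split_ifs with h
        · rw [distMap_apply, map_sum]
          simp only [dualIdem_apply]
          rw [← Finset.sum_filter, Finset.filter_filter]
          congr 1; ext y
          simp only [Finset.mem_filter, Finset.mem_univ, true_and, profile_eq_iff κ y ψ d hd]
          rw [e2 y, e3 y]
          tauto
        · rw [map_zero, map_zero]
          apply Finset.sum_eq_zero
          intro y hy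
          exact absurd ((profile_eq_iff κ y ψ d hd).1 (Finset.mem_filter.1 hy).2).2.2 h
      rw [← inner]
      refine Finset.sum_bij' (fun p _ => p.2.1) (fun y _ => (κ, y, ψ)) ?_ ?_ ?_ ?_ ?_
      · rintro ⟨x, y, z⟩ hp; simp at hp ⊢; obtain ⟨h, rfl, rfl⟩ := hp; exact h
      · intro y hy; simpa using hy
      · rintro ⟨x, y, z⟩ hp; simp at hp ⊢; obtain ⟨h, rfl, rfl⟩ := hp; simp
      · intro y _; rfl
      · intro p _; rfl
    rw [key]
    exact Subalgebra.smul_mem _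
      (mul_mem (mul_mem (dualIdem_mem _ _) (distMap_mem _ _)) (dualIdem_mem _ _)) _
  · have : profSum N d = 0 := by
      rw [profSum, Finset.filter_false_of_mem, Finset.sum_empty]
      intro p _ h
      apply hd
      rw [← h]
      exact (profile_dist _ _ _).2.2.2
    rw [this, map_zero]; exact zero_mem _

/-! ### The maps `‡` and `ϑ` -/

/-- The map `‡ : P_N → Fix(G)`, the restriction to `P_N` of the linear map on `P` that sends
`x^r y^s z^t w^u ↦ (N! 2^N)^{1/2} B̃(r, s, t, u)`. -/
def ddagMap (N : ℕ) : PolyN N →ₗ[ℂ] fixG N :=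
  ((MvPolynomial.basisMonomials (Fin 4) ℂ).constr ℂ fun d =>
    (Real.sqrt ((N.factorial : ℝ) * 2 ^ N) : ℂ) •
      (⟨profSumDual N d, Submodule.smul_mem _ _ (profSum_mem_fixG d)⟩ : fixG N)).comp
    (PolyN N).subtype

lemma epsMap_ddagMap_mem (κ : Vertex N) (f : PolyN N) :
    epsMap κ (ddagMap N f : StdMod3 N) ∈ Subalgebra.toSubmodule (subconstAlg κ) := by
  rw [ddagMap, LinearMap.comp_apply, Module.Basis.constr_apply, Finsupp.sum,
    AddSubmonoidClass.coe_finsetSum, map_sum]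
  refine Submodule.sum_mem _ fun d _ => ?_
  simp only [Submodule.coe_smul, profSumDual, map_smul]
  exact Submodule.smul_mem _ _ (Submodule.smul_mem _ _ (Submodule.smul_mem _ _
    (epsMap_profSum_mem κ d)))

/-- The map `ϑ : P_N → T`, the composition of `‡ : P_N → Fix(G)` with `ε`. -/
def thetaMap (κ : Vertex N) : PolyN N →ₗ[ℂ] subconstAlg κ :=
  LinearMap.codRestrict (Subalgebra.toSubmodule (subconstAlg κ))
    ((epsMap κ).comp ((fixG N).subtype.comp (ddagMap N))) (epsMap_ddagMap_mem κ)

end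

end HypercubeIso

/-! Everything reduces to a count. For vertices `y, z` put `d = profile κ y z`. Among the vectors
that occur in the profile sums, `ε` sends only `κ ⊗ y ⊗ z` to a nonzero multiple of `e_{y,z}`. Hence
the `(y, z)` entry of `ϑ f` is the coefficient of `f` at the exponent `d`, times the product of the
three normalising constants, `√(N! 2^N) · (r! s! t! u! / (N! 2^N)) · 2^(N/2) = r! s! t! u! / √(N!)`.

The form on `End V` sums over all pairs `(y, z)`, and its terms depend on the profile alone. The
pairs with profile `d` number `N! / (r! s! t! u!)`, since each coordinate is assigned freely to one
of four classes subject to the class sizes. So each exponent `d` of `f` contributes `(N! / (r! s! t!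
u!)) · (r! s! t! u!)² / N! = r! s! t! u!` times the coefficient of `f` and the conjugate coefficient
of `g`, which is its contribution to the form on `P`.

`factProd_mul_card_profile` carries the count, `unitBasis_repr_thetaMap` the matrix entries, and
`sqrt_mul_sqrt_two_pow` the cancellation of constants. -/

namespace HypercubeIso

/-! ### Counting functions by fibre sizes -/

/-- The number of maps from an `n`-element type with prescribed fibre sizes `d` is the
multinomial coefficient of `d`. -/
lemma card_filter_fiber_card_eq {ι α : Type*} [Fintype ι] [DecidableEq ι] [Fintype α]
    [DecidableEq α] (d : α → ℕ) (hd : ∑ a, d a = Fintype.card ι) :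
    (Finset.univ.filter fun f : ι → α => (fun a => (Finset.univ.filter fun i => f i = a).card)
      = d).card = Nat.multinomial Finset.univ d := by
  -- Distributing the power without collecting terms gives one monomial per function, whose exponent
  -- records the fibre sizes. The multinomial theorem collects the same terms, so the count is a
  -- coefficient comparison at `d`.
  have h1 : ((∑ a : α, (MvPolynomial.X a : MvPolynomial α ℕ)) ^ Fintype.card ι)
      = ∑ f : ι → α, MvPolynomial.monomial (Finsupp.equivFunOnFinite.symm
          fun a => (Finset.univ.filter fun i => f i = a).card) 1 := by
    rw [← Finset.card_univ, ← Finset.prod_const, Finset.prod_univ_sum, Fintype.piFinset_univ]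
    refine Finset.sum_congr rfl fun f _ => ?_
    rw [← Finset.prod_fiberwise' Finset.univ f (fun a => (MvPolynomial.X a : MvPolynomial α ℕ)),
      MvPolynomial.monomial_eq, Finsupp.prod_fintype _ _ (fun _ => pow_zero _)]
    simp
  have h2 := Finset.sum_pow_eq_sum_piAntidiag (Finset.univ : Finset α)
    (fun a => (MvPolynomial.X a : MvPolynomial α ℕ)) (Fintype.card ι)
  have h3 : ∀ k : α → ℕ, ((Nat.multinomial Finset.univ k : ℕ) : MvPolynomial α ℕ)
      * ∏ a, MvPolynomial.X a ^ k a
      = MvPolynomial.monomial (Finsupp.equivFunOnFinite.symm k)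
          (Nat.multinomial Finset.univ k) := by
    intro k
    rw [MvPolynomial.monomial_eq, Finsupp.prod_fintype _ _ (fun _ => pow_zero _)]
    simp
  simp only [h3] at h2
  have h4 := congrArg (MvPolynomial.coeff (Finsupp.equivFunOnFinite.symm d)) (h1.symm.trans h2)
  simp only [MvPolynomial.coeff_sum, MvPolynomial.coeff_monomial,
    EmbeddingLike.apply_eq_iff_eq] at h4
  -- `hd` is what places `d` among the exponents that occur in the multinomial theorem.
  rw [Finset.sum_boole, Finset.sum_ite_eq' _ d, if_pos (by simp [hd])] at h4
  exact_mod_cast h4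

/-! ### Counting pairs of vertices by profile -/

variable {N : ℕ}

lemma factProd_eq_prod (d : Fin 4 →₀ ℕ) : factProd d = ∏ i, (d i).factorial := by
  rw [Fin.prod_univ_four, factProd]

/-- The position of the coordinate at which `a, b, c` is counted by the profile. -/
def coordClass (a b c : ℤˣ) : Fin 4 :=
  if b = c then (if a = b then 0 else 1) else (if c = a then 2 else 3)

/-- Two of any three signs agree, so exactly one of the four profile conditions holds at each
coordinate. This turns profiles into vectors of fibre sizes. -/
lemma profile_eq_card_coordClass (x y z : Vertex N) :
    profile x y z
      = fun a => (Finset.univ.filter fun i => coordClass (x i) (y i) (z i) = a).card := by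
  have tri : ∀ a b c : ℤˣ,
      ((a = b ∧ b = c) ↔ coordClass a b c = 0) ∧ ((a ≠ b ∧ b = c) ↔ coordClass a b c = 1) ∧
      ((b ≠ c ∧ c = a) ↔ coordClass a b c = 2) ∧ ((c ≠ a ∧ a = b) ↔ coordClass a b c = 3) := by
    decide
  funext a
  fin_cases a
  · simp [profile, ← (tri _ _ _).1]
  · simp [profile, ← (tri _ _ _).2.1]
  · simp [profile, ← (tri _ _ _).2.2.1]
  · simp [profile, ← (tri _ _ _).2.2.2]

/-- For a fixed vertex `κ`, pairs of vertices correspond to maps from coordinates to classes. -/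
def pairEquiv (κ : Vertex N) : Vertex N × Vertex N ≃ (Fin N → Fin 4) where
  toFun p i := coordClass (κ i) (p.1 i) (p.2 i)
  -- Relative to `κ`, both vertices differ in class 1, only the first in class 2, only the second in
  -- class 3.
  invFun f := (fun i => if f i = 1 ∨ f i = 2 then -κ i else κ i,
    fun i => if f i = 1 ∨ f i = 3 then -κ i else κ i)
  left_inv := by
    have key : ∀ a b c : ℤˣ,
        (if coordClass a b c = 1 ∨ coordClass a b c = 2 then -a else a) = b ∧
        (if coordClass a b c = 1 ∨ coordClass a b c = 3 then -a else a) = c := by decide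
    rintro ⟨y, z⟩
    simp only [key]
  right_inv := by
    have key : ∀ (a : ℤˣ) (t : Fin 4), coordClass a (if t = 1 ∨ t = 2 then -a else a)
        (if t = 1 ∨ t = 3 then -a else a) = t := by decide
    intro f
    simp only [key]

/-- The number of pairs `(y, z)` such that `(κ, y, z)` has profile `d` is `N! / (r! s! t! u!)`. -/
lemma factProd_mul_card_profile (κ : Vertex N) (d : Fin 4 →₀ ℕ) (hd : ∑ i, d i = N) :
    factProd d * (Finset.univ.filter fun p : Vertex N × Vertex N => profile κ p.1 p.2 = ⇑d).card
      = N.factorial := by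
  have h := card_filter_fiber_card_eq (ι := Fin N) (⇑d) (by simpa using hd)
  have e : (Finset.univ.filter fun p : Vertex N × Vertex N => profile κ p.1 p.2 = ⇑d).card
      = Nat.multinomial Finset.univ ⇑d := by
    rw [← h]
    refine Finset.card_equiv (pairEquiv κ) fun p => ?_
    simp only [Finset.mem_filter, Finset.mem_univ, true_and, profile_eq_card_coordClass]
    rfl
  rw [e, factProd_eq_prod, Nat.multinomial_spec, hd]

/-! ### Matrix entries and coordinate formulas for the two forms -/

lemma unitBasis_repr_epsMap_profSum (κ : Vertex N) (d : Fin 4 →₀ ℕ) (p : Vertex N × Vertex N) :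
    (unitBasis N).repr (epsMap κ (profSum N d)) p
      = if profile κ p.1 p.2 = ⇑d then (((2 : ℝ) ^ ((N : ℝ) / 2) : ℝ) : ℂ) else 0 := by
  rw [profSum, map_sum, map_sum, Finset.sum_filter, Finsupp.finsetSum_apply,
    Finset.sum_eq_single (κ, p)]
  · split_ifs with h
    · rw [epsMap, Module.Basis.constr_basis]
      simp
    · simp
  · rintro ⟨x, q⟩ _ hne
    rw [epsMap]
    split_ifs with h
    · rw [Module.Basis.constr_basis]
      split_ifs with hx
      · have hx' : x = κ := hx
        subst hx'
        have : q ≠ p := fun h => hne (by rw [h])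
        simp [this]
      · simp
    · simp
  · simp

/-- The matrix entries of `ϑ f` in terms of the coefficients of `f`. -/
lemma unitBasis_repr_thetaMap (κ : Vertex N) (f : PolyN N) (p : Vertex N × Vertex N) :
    (unitBasis N).repr (thetaMap κ f : Module.End ℂ (StdMod N)) p
      = (Real.sqrt ((N.factorial : ℝ) * 2 ^ N) : ℂ)
          * ((factProd (Finsupp.equivFunOnFinite.symm (profile κ p.1 p.2)) : ℂ)
            / ((N.factorial : ℂ) * 2 ^ N)) * (((2 : ℝ) ^ ((N : ℝ) / 2) : ℝ) : ℂ)
        * MvPolynomial.coeff (Finsupp.equivFunOnFinite.symm (profile κ p.1 p.2)) (f : Poly) := by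
  set e := Finsupp.equivFunOnFinite.symm (profile κ p.1 p.2) with he
  have hiff : ∀ d : Fin 4 →₀ ℕ, profile κ p.1 p.2 = ⇑d ↔ d = e := by
    intro d
    rw [he, Equiv.eq_symm_apply, eq_comm]; rfl
  have h0 : (thetaMap κ f : Module.End ℂ (StdMod N)) = epsMap κ (ddagMap N f : StdMod3 N) := rfl
  rw [h0, ddagMap, LinearMap.comp_apply, Module.Basis.constr_apply, Finsupp.sum,
    AddSubmonoidClass.coe_finsetSum, map_sum, map_sum, Finsupp.finsetSum_apply]
  simp only [Submodule.coe_smul, profSumDual, map_smul, Finsupp.smul_apply, smul_eq_mul,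
    unitBasis_repr_epsMap_profSum, hiff, mul_ite, mul_zero]
  rw [Finset.sum_ite_eq']
  have hc : ((MvPolynomial.basisMonomials (Fin 4) ℂ).repr ((PolyN N).subtype f)) e
      = MvPolynomial.coeff e (f : Poly) := rfl
  rw [hc]
  -- The sum ran only over the support of `f`; outside it the coefficient at `e` vanishes, so the
  -- formula still holds.
  split_ifs with h
  · ring
  · have : MvPolynomial.coeff e (f : Poly) = 0 := by
      rw [← hc]; exact Finsupp.notMem_support_iff.1 h
    rw [this, mul_zero]

lemma endForm_eq_sum (a b : Module.End ℂ (StdMod N)) :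
    endForm a b = ∑ p : Vertex N × Vertex N,
      (unitBasis N).repr a p * (starRingEnd ℂ) ((unitBasis N).repr b p) := by
  rw [endForm, hermForm, Finsupp.sum_fintype _ _ (by simp)]
  simp

lemma polyForm_eq_sum (f g : Poly) :
    polyForm f g = ∑ d ∈ f.support, (factProd d : ℂ) *
      (MvPolynomial.coeff d f * (starRingEnd ℂ) (MvPolynomial.coeff d g)) := by
  rw [polyForm, hermForm]
  simp only [Complex.ofReal_natCast]
  rfl

/-- The powers of two cancel, so the scalar being squared is `c / √(N!)`. Squaring avoids handling
the roots themselves. -/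
lemma sqrt_mul_sqrt_two_pow (N : ℕ) (c : ℂ) :
    ((Real.sqrt ((N.factorial : ℝ) * 2 ^ N) : ℂ) * (c / ((N.factorial : ℂ) * 2 ^ N))
      * (((2 : ℝ) ^ ((N : ℝ) / 2) : ℝ) : ℂ)) ^ 2 * N.factorial = c ^ 2 := by
  have h1 : (Real.sqrt ((N.factorial : ℝ) * 2 ^ N) : ℂ) ^ 2 = (N.factorial : ℂ) * 2 ^ N := by
    rw [← Complex.ofReal_pow, Real.sq_sqrt (by positivity)]; push_cast; rfl
  have h2 : (((2 : ℝ) ^ ((N : ℝ) / 2) : ℝ) : ℂ) ^ 2 = 2 ^ N := by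
    rw [← Complex.ofReal_pow, ← Real.rpow_natCast, ← Real.rpow_mul (by norm_num)]
    norm_num
  have h3 : (N.factorial : ℂ) ≠ 0 := by exact_mod_cast N.factorial_ne_zero
  rw [mul_pow, mul_pow, h1, h2]
  field_simp

end HypercubeIso

/-! ### The isometry -/

open HypercubeIso in
theorem mainTheorem8 (N : ℕ) (κ : HypercubeIso.Vertex N) (f g : HypercubeIso.PolyN N) :
    HypercubeIso.polyForm (f : HypercubeIso.Poly) (g : HypercubeIso.Poly) =
      HypercubeIso.endForm
        (HypercubeIso.thetaMap κ f : Module.End ℂ (HypercubeIso.StdMod N))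
        (HypercubeIso.thetaMap κ g : Module.End ℂ (HypercubeIso.StdMod N)) := by
  rw [polyForm_eq_sum, endForm_eq_sum]
  simp only [unitBasis_repr_thetaMap]
  set K : (Fin 4 →₀ ℕ) → ℂ := fun d => (Real.sqrt ((N.factorial : ℝ) * 2 ^ N) : ℂ) *
    ((factProd d : ℂ) / ((N.factorial : ℂ) * 2 ^ N)) * (((2 : ℝ) ^ ((N : ℝ) / 2) : ℝ) : ℂ) with hK
  -- The scalars are real, so the two entries together contribute `K d ^ 2`.
  have hKc : ∀ d, (starRingEnd ℂ) (K d) = K d := by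
    intro d
    simp only [hK, map_mul, map_div₀, map_pow, Complex.conj_ofReal, map_natCast, map_ofNat]
  set F : (Fin 4 →₀ ℕ) → ℂ := fun d => K d ^ 2 * (MvPolynomial.coeff d (f : Poly) *
    (starRingEnd ℂ) (MvPolynomial.coeff d (g : Poly))) with hF
  set π : Vertex N × Vertex N → (Fin 4 →₀ ℕ) := fun p =>
    Finsupp.equivFunOnFinite.symm (profile κ p.1 p.2) with hπ
  have hr : ∀ p : Vertex N × Vertex N, K (π p) * MvPolynomial.coeff (π p) (f : Poly) *
      (starRingEnd ℂ) (K (π p) * MvPolynomial.coeff (π p) (g : Poly)) = F (π p) := by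
    intro p
    rw [map_mul, hKc]
    simp only [hF]
    ring
  refine Eq.trans ?_ (Finset.sum_congr rfl fun p _ => (hr p).symm)
  -- Pairs whose profile lies outside the support of `f` contribute zero; the rest are grouped by
  -- profile, on which the summand is constant.
  rw [← Finset.sum_filter_of_ne (p := fun p => π p ∈ (f : Poly).support)
    (fun p _ h => by
      rw [MvPolynomial.mem_support_iff]
      intro h0
      exact h (by simp only [hF, h0, zero_mul, mul_zero])),
    ← Finset.sum_fiberwise_of_maps_to' (t := (f : Poly).support) (g := π)
      (fun p hp => (Finset.mem_filter.1 hp).2) F]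
  refine Finset.sum_congr rfl fun d hd => ?_
  -- Homogeneity enters here: exponents of `f` have total degree `N`, as the count requires.
  have hdN : ∑ i, d i = N := by
    have h := (MvPolynomial.mem_homogeneousSubmodule _ _).1 f.2 (MvPolynomial.mem_support_iff.1 hd)
    rw [← Finsupp.degree_eq_sum, Finsupp.degree_eq_weight_one]
    exact h
  have hcard := factProd_mul_card_profile κ d hdN
  rw [Finset.sum_const, Finset.filter_filter]
  have hset : (Finset.univ.filter fun p => π p ∈ (f : Poly).support ∧ π p = d)
      = Finset.univ.filter fun p : Vertex N × Vertex N => profile κ p.1 p.2 = ⇑d := by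
    ext p
    simp only [Finset.mem_filter, Finset.mem_univ, true_and]
    have : π p = d ↔ profile κ p.1 p.2 = ⇑d := by
      rw [hπ, Equiv.symm_apply_eq]; rfl
    rw [← this]
    exact ⟨fun h => h.2, fun h => ⟨h ▸ hd, h⟩⟩
  rw [hset, nsmul_eq_mul]
  simp only [hF]
  have hne : (factProd d : ℂ) ≠ 0 := by
    rw [factProd_eq_prod]
    exact_mod_cast Finset.prod_ne_zero_iff.2 fun i _ => Nat.factorial_ne_zero _
  -- Scaling by `factProd d` turns the number of pairs into `N!` and avoids division.
  apply mul_left_cancel₀ hne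
  have hc : (factProd d : ℂ) * ((Finset.univ.filter fun p : Vertex N × Vertex N =>
      profile κ p.1 p.2 = ⇑d).card : ℂ) = N.factorial := by exact_mod_cast hcard
  have hq : K d ^ 2 * N.factorial = (factProd d : ℂ) ^ 2 := sqrt_mul_sqrt_two_pow N (factProd d)
  rw [← hc] at hq
  linear_combination (-(MvPolynomial.coeff d (f : Poly) *
    (starRingEnd ℂ) (MvPolynomial.coeff d (g : Poly)))) * hq
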